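/- Let $G$ be a finite group with $|G| \leq 200$. (1) If $G$ is perfect, i.e. equal to its commutator subgroup $(G,G)$, and $G \neq \{1\}$, then $|G| \in \{60, 120, 168, 180\}$. (2) If $G$ is simple and non-abelian, then either $|G| = 60$ and $G$ is isomorphic to the alternating group $\mathcal{A}_5$, or $|G| = 168$ and $G$ is isomorphic to $\mathbf{PSL}_2(\mathbf{F}_7)$. -/

import Mathlib

/-!
Let `G` be a noncommutative simple group of order `n = p ^ a * m ≤ 200` with `p ∤ m`, and let `d` be
the number of its Sylow `p`-subgroups, a divisor of `m` congruent to `1` modulo `p`. Three further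
constraints on `d` are collected in `IsSylowCandidate`. Since `G` acts faithfully and by even
permutations on the Sylow subgroups, `n` divides `d! / 2`. Since the alternating group of degree
`d ≥ 5` is simple as well, the index `k` of `G` in it is `1` or satisfies `d! / 2 ∣ k! / 2`; this
excludes the orders `120` and `180`. Finally, Burnside's transfer theorem forbids that a commutative
Sylow subgroup be its own normalizer, so `d ≠ m` when `a ≤ 2`. A finite verification shows that for
`n ≠ 60, 168` some prime `p` leaves no possible `d`. A nontrivial perfect group has a noncommutative
simple quotient, so the order of a perfect group of order at most `200` is a multiple of `60` or
`168`.

For `n = 60` the constraints force five Sylow `2`-subgroups, and `G` is the alternating group of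
degree five for reasons of order.

For `n = 168` there are eight Sylow `7`-subgroups, with normalizers of order `21`. By Burnside's
theorem such a normalizer is not commutative, and its eight-point action can be labelled as
`x ↦ x + b`, `x ↦ 2 x` on the projective line over `ZMod 7`
(`exists_action_projectiveLine`). The subgroup generated by `y : x ↦ 2 x` is a Sylow `3`-subgroup,
and again by Burnside's theorem some element inverts `y`; a suitable power of it is an involution,
which exchanges the fixed points `0` and `∞` of `y` and acts as `x ↦ c / x`. Involutions have no
fixed point as stabilizers have odd order, so `c` is not a square, and after multiplication by a
power of `y` one has `c = -1` (`exists_nonsquare_apply_one`). Hence the image of `G` contains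
the homographies `x ↦ x + 1` and `x ↦ -1 / x`, which generate the image of the special linear group;
this image has order `168` too, and is the projective special linear group.
-/

/-! ### Burnside transfer and permutation representations of simple groups -/

/-- In a noncommutative simple group no Sylow subgroup is central in its normalizer: otherwise
the normal complement given by Burnside's transfer theorem would be trivial or the whole group, which
makes the group commutative or the Sylow subgroup trivial. -/
theorem Sylow.not_normalizer_le_centralizer {G : Type*} [Group G] [Finite G] [IsSimpleGroup G]
    (hG : ¬ IsMulCommutative G) {p : ℕ} [Fact p.Prime] (hp : p ∣ Nat.card G) (P : Sylow p G) :
    ¬ Subgroup.normalizer (P : Set G) ≤ Subgroup.centralizer (P : Set G) := by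
  intro h
  have hc := MonoidHom.ker_transferSylow_isComplement' P h
  rcases (inferInstance : (MonoidHom.transferSylow P h).ker.Normal).eq_bot_or_eq_top with hk | hk
  · rw [hk] at hc
    have hP : (P : Subgroup G) = ⊤ := Subgroup.isComplement'_bot_left.mp hc
    refine hG (.of_comm fun a b ↦ ?_)
    have hmem (x : G) : x ∈ (P : Subgroup G) := hP ▸ Subgroup.mem_top x
    exact (h (Subgroup.le_normalizer (hmem a)) b (hmem b)).symm
  · -- if the transfer is trivial, `P` is trivial
    rw [hk] at hc
    exact P.ne_bot_of_dvd_card hp (Subgroup.isComplement'_top_left.mp hc)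

/-- A noncommutative simple group with a nontrivial action on a finite set acts faithfully and by
even permutations. -/
theorem exists_injective_alternatingGroup {G : Type*} [Group G] [IsSimpleGroup G]
    (hG : ¬ IsMulCommutative G) {α : Type*} [Fintype α] [DecidableEq α]
    (f : G →* Equiv.Perm α) (hf : f ≠ 1) :
    ∃ ψ : G →* alternatingGroup α, Function.Injective ψ ∧ ∀ g, (ψ g : Equiv.Perm α) = f g := by
  have hinj : Function.Injective f := by
    rw [← MonoidHom.ker_eq_bot_iff]
    refine (inferInstance : f.ker.Normal).eq_bot_or_eq_top.resolve_right fun h ↦ hf ?_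
    rwa [← MonoidHom.ker_eq_top_iff]
  have hs : (Equiv.Perm.sign.comp f) = 1 := by
    rw [← MonoidHom.ker_eq_top_iff]
    refine (inferInstance : (Equiv.Perm.sign.comp f).ker.Normal).eq_bot_or_eq_top.resolve_left
      fun h ↦ hG (.of_comm fun a b ↦ ?_)
    rw [MonoidHom.ker_eq_bot_iff] at h
    exact h (by rw [map_mul, map_mul, mul_comm])
  refine ⟨f.codRestrict _ fun g ↦ ?_, fun a b h ↦ hinj (congrArg Subtype.val h), fun g ↦ rfl⟩
  exact Equiv.Perm.mem_alternatingGroup.mpr (DFunLike.congr_fun hs g)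

theorem exists_injective_alternatingGroup_index {G : Type*} [Group G] [Finite G] [IsSimpleGroup G]
    (hG : ¬ IsMulCommutative G) (H : Subgroup G) (hH : H ≠ ⊤) :
    ∃ ψ : G →* alternatingGroup (Fin H.index), Function.Injective ψ := by
  let e : G ⧸ H ≃ Fin H.index := Finite.equivFin (G ⧸ H)
  let f : G →* Equiv.Perm (Fin H.index) :=
    e.permCongrHom.toMonoidHom.comp (MulAction.toPermHom G (G ⧸ H))
  have hf : f ≠ 1 := fun h ↦ hH <| by
    rw [eq_top_iff]
    intro g _
    have h1 : MulAction.toPermHom G (G ⧸ H) g = 1 :=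
      e.permCongrHom.injective ((DFunLike.congr_fun h g).trans (map_one _).symm)
    have h2 : g • ((1 : G) : G ⧸ H) = ((1 : G) : G ⧸ H) := Equiv.congr_fun h1 ((1 : G) : G ⧸ H)
    rw [MulAction.Quotient.smul_coe, eq_comm, QuotientGroup.eq] at h2
    simpa using h2
  obtain ⟨ψ, hψ, -⟩ := exists_injective_alternatingGroup hG f hf
  exact ⟨ψ, hψ⟩

theorem card_dvd_factorial_index_div_two {G : Type*} [Group G] [Finite G] [IsSimpleGroup G]
    (hG : ¬ IsMulCommutative G) (H : Subgroup G) (hH : H ≠ ⊤) :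
    Nat.card G ∣ H.index.factorial / 2 := by
  obtain ⟨ψ, hψ⟩ := exists_injective_alternatingGroup_index hG H hH
  have : Nontrivial (Fin H.index) := by
    rw [Fin.nontrivial_iff_two_le]
    have := mt Subgroup.index_eq_one.mp hH
    have := H.index_ne_zero_of_finite
    omega
  have := Subgroup.card_dvd_of_injective ψ hψ
  rwa [nat_card_alternatingGroup, Nat.card_fin] at this

/-- If a noncommutative simple group of order `n` has a proper subgroup of index `k ≥ 5`, then it is
a subgroup of index `m = (k! / 2) / n` in `alternatingGroup (Fin k)`; the latter being simple
itself, `m ≠ 1` bounds its order by `m! / 2`. -/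
theorem factorial_index_div_two_dvd {G : Type*} [Group G] [Finite G] [IsSimpleGroup G]
    (hG : ¬ IsMulCommutative G) (H : Subgroup G) (h5 : 5 ≤ H.index) {m : ℕ} (hm : 1 < m)
    (h : H.index.factorial / 2 = Nat.card G * m) :
    H.index.factorial / 2 ∣ m.factorial / 2 := by
  obtain ⟨ψ, hψ⟩ := exists_injective_alternatingGroup_index hG H (by rintro rfl; simp at h5)
  have : Nontrivial (Fin H.index) := Fin.nontrivial_iff_two_le.mpr (by omega)
  have hc : Nat.card (alternatingGroup (Fin H.index)) = H.index.factorial / 2 := by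
    rw [nat_card_alternatingGroup, Nat.card_fin]
  have := alternatingGroup.isSimpleGroup (α := Fin H.index) (by simpa)
  have hr : Nat.card ψ.range = Nat.card G := (Nat.card_congr (ψ.ofInjective hψ).toEquiv).symm
  have hi : ψ.range.index = m := by
    have := ψ.range.card_mul_index
    rw [hr, hc, h] at this
    exact Nat.eq_of_mul_eq_mul_left Nat.card_pos this
  have hA : ¬ IsMulCommutative (alternatingGroup (Fin H.index)) := by
    rw [alternatingGroup.isMulCommutative_iff_card_le_three, Nat.card_fin]
    omega
  have := card_dvd_factorial_index_div_two hA ψ.range fun ht ↦ by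
    rw [ht, Subgroup.index_top] at hi
    omega
  rwa [hc, hi] at this

/-! ### Orders of simple groups -/

/-- The arithmetic constraints on the number `d` of Sylow `p`-subgroups of a noncommutative simple
group of order `p ^ a * m`, with `p ∤ m`. The last two clauses are restricted to small `d` and `k`,
which suffices for orders up to `200` and keeps the factorials small. -/
def IsSylowCandidate (p a m d : ℕ) : Prop :=
  1 < d ∧ d ∣ m ∧ d % p = 1 ∧ (a ≤ 2 → d ≠ m) ∧
    (d < 12 → p ^ a * m ∣ d.factorial / 2) ∧
      (5 ≤ d → ∀ k < 4, 1 < k → d.factorial / 2 = p ^ a * m * k →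
        d.factorial / 2 ∣ k.factorial / 2)

instance (p a m d : ℕ) : Decidable (IsSylowCandidate p a m d) := by
  unfold IsSylowCandidate
  infer_instance

theorem Sylow.isSylowCandidate {G : Type*} [Group G] [Finite G] [IsSimpleGroup G]
    (hG : ¬ IsMulCommutative G) {p a m : ℕ} [Fact p.Prime] (ha : a ≠ 0) (hm : ¬ p ∣ m)
    (hn : Nat.card G = p ^ a * m) (P : Sylow p G) :
    IsSylowCandidate p a m (Subgroup.normalizer (P : Set G)).index ∧ Nat.card P = p ^ a := by
  have hp : p.Prime := Fact.out
  have hm0 : m ≠ 0 := by rintro rfl; simp at hm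
  have hPc : Nat.card P = p ^ a := by
    rw [P.card_eq_multiplicity, hn, Nat.factorization_mul (pow_ne_zero _ hp.ne_zero) hm0]
    simp [hp.factorization_self, Nat.factorization_eq_zero_of_not_dvd hm]
  have hi : (P : Subgroup G).index = m := by
    have := (P : Subgroup G).card_mul_index
    rw [hPc, hn] at this
    exact Nat.eq_of_mul_eq_mul_left (pow_pos hp.pos a) this
  have hT := P.not_normalizer_le_centralizer hG (hn ▸ (dvd_pow_self p ha).mul_right m)
  have hpG : ¬ IsPGroup p G := fun h ↦ by
    have := h.center_nontrivial
    rcases (inferInstance : (Subgroup.center G).Normal).eq_bot_or_eq_top with h | h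
    · exact (Subgroup.nontrivial_iff_ne_bot _).mp this h
    · exact hG (.of_comm fun a b ↦ (Subgroup.mem_center_iff.mp (h ▸ Subgroup.mem_top b) a))
  have hN : Subgroup.normalizer (P : Set G) ≠ ⊤ := fun h ↦ by
    rcases (Subgroup.normalizer_eq_top_iff.mp h).eq_bot_or_eq_top with h | h
    · exact P.ne_bot_of_dvd_card (hn ▸ (dvd_pow_self p ha).mul_right m) h
    · refine hpG (IsPGroup.of_card (n := a) ?_)
      rw [← hPc, ← Subgroup.card_top (G := G), ← h]
  refine ⟨⟨?_, ?_, ?_, ?_, ?_, ?_⟩, hPc⟩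
  · have := mt Subgroup.index_eq_one.mp hN
    have := (Subgroup.normalizer (P : Set G)).index_ne_zero_of_finite
    omega
  · exact hi ▸ Subgroup.index_dvd_of_le Subgroup.le_normalizer
  · have := card_sylow_modEq_one p G
    rw [P.card_eq_index_normalizer] at this
    exact Eq.trans this (Nat.mod_eq_of_lt hp.one_lt)
  · -- otherwise `P` is self-normalizing, and commutative since its order is `1`, `p` or `p ^ 2`
    intro ha2 hd
    have hle : (P : Subgroup G) ≤ Subgroup.normalizer (P : Set G) := Subgroup.le_normalizer
    have hPN : (P : Subgroup G) = Subgroup.normalizer (P : Set G) := by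
      refine Subgroup.eq_of_le_of_card_ge hle (le_of_eq ?_)
      have h1 := (P : Subgroup G).card_mul_index
      have h2 := (Subgroup.normalizer (P : Set G)).card_mul_index
      rw [hi] at h1
      rw [hd, ← h1] at h2
      exact Nat.eq_of_mul_eq_mul_right (Nat.pos_of_ne_zero hm0) h2
    have hcomm : IsMulCommutative P := by
      have : a = 1 ∨ a = 2 := by omega
      rcases this with rfl | rfl
      · have := isCyclic_of_prime_card (hPc.trans (pow_one p))
        exact IsCyclic.isMulCommutative
      · exact IsPGroup.isMulCommutative_of_card_eq_prime_sq hPc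
    refine hT fun x hx y hy ↦ ?_
    rw [← hPN] at hx
    exact congrArg Subtype.val (mul_comm' (⟨y, hy⟩ : P) ⟨x, hx⟩)
  · intro _
    exact hn ▸ card_dvd_factorial_index_div_two hG _ hN
  · intro h5 k _ hk hkd
    exact factorial_index_div_two_dvd hG _ h5 hk (hn ▸ hkd)

/-- The finite verification behind the classification of the orders. The bound on `d` is that on the
index `n / p ^ a ≤ n / 2`. -/
theorem exists_prime_forall_not_isSylowCandidate : ∀ n ∈ Finset.Icc 2 200, n ≠ 60 → n ≠ 168 →
    ∃ p ∈ Finset.range 200, ∃ a ∈ Finset.Icc 1 7, p.Prime ∧ n % p ^ a = 0 ∧ ¬ p ∣ n / p ^ a ∧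
      ∀ d ∈ Finset.range 101, ¬ IsSylowCandidate p a (n / p ^ a) d := by
  decide +kernel

theorem card_eq_of_isSimpleGroup {G : Type*} [Group G] [Finite G] [IsSimpleGroup G]
    (hG : ¬ IsMulCommutative G) (h200 : Nat.card G ≤ 200) :
    Nat.card G = 60 ∨ Nat.card G = 168 := by
  by_contra! h
  obtain ⟨p, -, a, ha, hp, hpa, hm, H⟩ := exists_prime_forall_not_isSylowCandidate (Nat.card G)
    (Finset.mem_Icc.mpr ⟨Finite.one_lt_card, h200⟩) h.1 h.2
  have := Fact.mk hp
  have ha1 : 1 ≤ a := (Finset.mem_Icc.mp ha).1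
  have hn : Nat.card G = p ^ a * (Nat.card G / p ^ a) :=
    (Nat.mul_div_cancel' (Nat.dvd_of_mod_eq_zero hpa)).symm
  obtain ⟨P⟩ : Nonempty (Sylow p G) := inferInstance
  have hc := (P.isSylowCandidate hG (by omega) hm hn).1
  refine H _ (Finset.mem_range.mpr ?_) hc
  have hpa2 : 2 ≤ p ^ a := hp.two_le.trans (Nat.le_self_pow (by omega) p)
  have hle : Nat.card G / p ^ a ≤ 200 / 2 := Nat.div_le_div h200 hpa2 (by norm_num)
  have hpos : 0 < Nat.card G / p ^ a := Nat.pos_of_ne_zero fun h0 ↦ by simp [h0] at hm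
  exact Nat.lt_succ_of_le ((Nat.le_of_dvd hpos hc.2.1).trans hle)

/-- A nontrivial perfect group has a noncommutative simple quotient, whose order is `60` or
`168`. -/
theorem dvd_card_of_isPerfect (n : ℕ) : ∀ (G : Type*) [Group G] [Finite G] [Nontrivial G]
    [Group.IsPerfect G], Nat.card G = n → n ≤ 200 → 60 ∣ n ∨ 168 ∣ n := by
  induction n using Nat.strong_induction_on with
  | _ n ih =>
    intro G _ _ _ _ hn h200
    by_cases hs : IsSimpleGroup G
    · have := card_eq_of_isSimpleGroup (Group.IsPerfect.not_isMulCommutative (G := G)) (hn ▸ h200)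
      omega
    · obtain ⟨N, hN, hbot, htop⟩ : ∃ N : Subgroup G, N.Normal ∧ N ≠ ⊥ ∧ N ≠ ⊤ := by
        by_contra! h
        exact hs ⟨fun N hN ↦ or_iff_not_imp_left.mpr (h N hN)⟩
      have hq := N.card_eq_card_quotient_mul_card_subgroup
      have hN1 : 1 < Nat.card N := (Subgroup.one_lt_card_iff_ne_bot N).mpr hbot
      have hq0 : 0 < Nat.card (G ⧸ N) := Nat.card_pos
      have hlt : Nat.card (G ⧸ N) < n := by rw [← hn, hq]; nlinarith
      have : Nontrivial (G ⧸ N) := QuotientGroup.nontrivial_iff.mpr htop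
      have hdvd : Nat.card (G ⧸ N) ∣ n := hn ▸ Dvd.intro _ hq.symm
      exact (ih _ hlt (G ⧸ N) rfl (by omega)).imp (·.trans hdvd) (·.trans hdvd)

/-- A simple group of order `60` has five Sylow `2`-subgroups, and is therefore isomorphic to the
alternating group of the set they form. -/
theorem nonempty_mulEquiv_alternatingGroup_five {G : Type*} [Group G] [Finite G] [IsSimpleGroup G]
    (hG : ¬ IsMulCommutative G) (h60 : Nat.card G = 60) :
    Nonempty (G ≃* alternatingGroup (Fin 5)) := by
  obtain ⟨P⟩ : Nonempty (Sylow 2 G) := inferInstance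
  have hc := (P.isSylowCandidate hG (a := 2) (m := 15) (by norm_num) (by norm_num) (by omega)).1
  have h5 : (Subgroup.normalizer (P : Set G)).index = 5 := by
    have : ∀ d ∈ Finset.range 16, IsSylowCandidate 2 2 15 d → d = 5 := by decide +kernel
    exact this _ (Finset.mem_range.mpr (Nat.lt_succ_of_le (Nat.le_of_dvd (by norm_num) hc.2.1))) hc
  obtain ⟨ψ, hψ⟩ : ∃ ψ : G →* alternatingGroup (Fin 5), Function.Injective ψ :=
    h5 ▸ exists_injective_alternatingGroup_index hG _ fun h ↦ by simp [h] at h5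
  refine ⟨MulEquiv.ofBijective ψ ((Nat.bijective_iff_injective_and_card ψ).mpr ⟨hψ, ?_⟩)⟩
  rw [h60, nat_card_alternatingGroup, Nat.card_fin]
  rfl

/-! ### Homographies of the projective line -/

open Matrix Matrix.SpecialLinearGroup in
/-- The homography `x ↦ (a x + b) / (c x + d)` of the projective line attached to a matrix of
determinant one. -/
noncomputable def homography (K : Type*) [Field K] [DecidableEq K] :
    Matrix.SpecialLinearGroup (Fin 2) K →* Equiv.Perm (OnePoint K) :=
  (MulAction.toPermHom (GL (Fin 2) K) (OnePoint K)).comp toGL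

section
variable {K : Type*} [Field K] [DecidableEq K]

open OnePoint

theorem homography_infty (A : Matrix.SpecialLinearGroup (Fin 2) K) :
    homography K A ∞ = if A 1 0 = 0 then ∞ else ((A 0 0 / A 1 0 : K) : OnePoint K) :=
  OnePoint.smul_infty_eq_ite _

theorem homography_coe (A : Matrix.SpecialLinearGroup (Fin 2) K) (x : K) :
    homography K A x = if A 1 0 * x + A 1 1 = 0 then ∞ else
      (((A 0 0 * x + A 0 1) / (A 1 0 * x + A 1 1) : K) : OnePoint K) :=
  OnePoint.smul_some_eq_ite

theorem ker_homography :
    (homography K).ker = Subgroup.center (Matrix.SpecialLinearGroup (Fin 2) K) := by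
  ext A
  rw [MonoidHom.mem_ker, Matrix.SpecialLinearGroup.mem_center_iff]
  have hdet := A.det_coe
  rw [Matrix.det_fin_two] at hdet
  constructor
  · intro h
    have h1 := homography_infty A
    have h2 := homography_coe A 0
    have h3 := homography_coe A 1
    rw [h, Equiv.Perm.one_apply] at h1 h2 h3
    have h10 : A 1 0 = 0 := by
      by_contra hne
      simp [hne] at h1
    have h11 : A 1 1 ≠ 0 := by
      intro h11
      simp [h10, h11] at hdet
    have h01 : A 0 1 = 0 := by
      simpa [h10, h11, eq_comm (a := (0 : K))] using h2
    have h00 : A 0 0 = A 1 1 := by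
      simp only [h10, h01, h11, OnePoint.coe_eq_coe, mul_one, zero_add, add_zero, if_false] at h3
      rw [eq_div_iff h11, one_mul] at h3
      exact h3.symm
    refine ⟨A 0 0, ?_, ?_⟩
    · rw [Fintype.card_fin, sq]
      nth_rewrite 2 [h00]
      simpa [h10] using hdet
    · ext i j
      fin_cases i <;> fin_cases j <;> simp [h10, h01, h00]
  · rintro ⟨r, hr, hA⟩
    have hr0 : r ≠ 0 := by rintro rfl; simp at hr
    have h00 : A 0 0 = r := by simp [← hA]
    have h11 : A 1 1 = r := by simp [← hA]
    have h01 : A 0 1 = 0 := by simp [← hA]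
    have h10 : A 1 0 = 0 := by simp [← hA]
    ext x
    cases x with
    | infty => simp [homography_infty, h10]
    | coe x => simp [homography_coe, h10, h11, h00, h01, hr0]

/-- The matrix of the homography `x ↦ -1 / x`. -/
def inversionMatrix (K : Type*) [Field K] : Matrix.SpecialLinearGroup (Fin 2) K :=
  ⟨!![0, -1; 1, 0], by simp [Matrix.det_fin_two]⟩

end

open Matrix.SpecialLinearGroup in
/-- Over a prime field, the homographies `x ↦ x + 1` and `x ↦ -1 / x` generate the image of
the special linear group. -/
theorem range_homography_le {p : ℕ} [Fact p.Prime] {H : Subgroup (Equiv.Perm (OnePoint (ZMod p)))}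
    (h1 : homography (ZMod p) (transvection zero_ne_one 1) ∈ H)
    (h2 : homography (ZMod p) (inversionMatrix (ZMod p)) ∈ H) :
    (homography (ZMod p)).range ≤ H := by
  have hT (c : ZMod p) : homography (ZMod p) (transvection zero_ne_one c) ∈ H := by
    rw [← ZMod.natCast_zmod_val c]
    induction c.val with
    | zero => rw [Nat.cast_zero, transvection_coeff_zero, map_one]; exact H.one_mem
    | succ n ih =>
      rw [Nat.cast_succ, transvection_add, map_mul]
      exact H.mul_mem ih h1
  rintro _ ⟨A, rfl⟩
  refine Matrix.SL2.transvection_induction (fun A ↦ homography (ZMod p) A ∈ H)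
    (fun i j hij c ↦ ?_) (fun A B hA hB ↦ by rw [map_mul]; exact H.mul_mem hA hB) A
  fin_cases i <;> fin_cases j
  · exact absurd rfl hij
  · exact hT c
  · -- a lower transvection is an upper one conjugated by the inversion
    have : transvection hij c = inversionMatrix (ZMod p) * transvection zero_ne_one (-c) *
        (inversionMatrix (ZMod p))⁻¹ := by
      rw [eq_mul_inv_iff_mul_eq]
      refine Subtype.ext ?_
      rw [coe_mul, coe_mul, transvection_coe, transvection_coe]
      ext i j
      fin_cases i <;> fin_cases j <;>
        simp [inversionMatrix, Matrix.mul_apply, Fin.sum_univ_two]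
    rw [this, map_mul, map_mul, map_inv]
    exact H.mul_mem (H.mul_mem h2 (hT _)) (H.inv_mem h2)
  · exact absurd rfl hij

instance fact_prime_seven : Fact (Nat.Prime 7) := ⟨by norm_num⟩

theorem le_card_range_homography : 168 ≤ Nat.card (homography (ZMod 7)).range := by
  have hSL : Nat.card (Matrix.SpecialLinearGroup (Fin 2) (ZMod 7)) = 336 := by
    rw [Nat.card_eq_fintype_card]
    decide +kernel
  have hZ : Nat.card (homography (ZMod 7)).ker ≤ 2 := by
    rw [ker_homography, Nat.card_congr
      (Matrix.SpecialLinearGroup.center_equiv_rootsOfUnity' (0 : Fin 2)).toEquiv,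
      Fintype.card_fin]
    exact card_rootsOfUnity _ _
  have := (homography (ZMod 7)).ker.card_mul_index
  rw [Subgroup.index_ker, hSL] at this
  nlinarith

theorem nonempty_mulEquiv_projectiveSpecialLinearGroup {G : Type*} [Group G] [Finite G]
    (h168 : Nat.card G = 168) (f : G →* Equiv.Perm (OnePoint (ZMod 7)))
    (hf : Function.Injective f)
    (h1 : homography (ZMod 7) (Matrix.SpecialLinearGroup.transvection zero_ne_one 1) ∈ f.range)
    (h2 : homography (ZMod 7) (inversionMatrix (ZMod 7)) ∈ f.range) :
    Nonempty (G ≃* Matrix.ProjectiveSpecialLinearGroup (Fin 2) (ZMod 7)) := by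
  have hr : (homography (ZMod 7)).range = f.range := by
    refine Subgroup.eq_of_le_of_card_ge (range_homography_le h1 h2) ?_
    rw [← Nat.card_congr (f.ofInjective hf).toEquiv, h168]
    exact le_card_range_homography
  exact ⟨((f.ofInjective hf).trans (MulEquiv.subgroupCongr hr.symm)).trans
    ((QuotientGroup.quotientMulEquivOfEq ker_homography.symm).trans
      (QuotientGroup.quotientKerEquivRange (homography (ZMod 7)))).symm⟩

/-! ### Simple groups of order 168 -/

section

open OnePoint

theorem conj_pow_pow {G : Type*} [Group G] {x y : G} {k : ℕ} (h : x * y * x⁻¹ = y ^ k) (n : ℕ) :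
    x ^ n * y * (x ^ n)⁻¹ = y ^ k ^ n := by
  induction n with
  | zero => simp
  | succ n ih =>
    rw [pow_succ' x, mul_inv_rev, pow_succ' k, pow_mul, ← h, conj_pow, ← ih]
    group

theorem mul_pow_eq_pow_mul_of_conj {G : Type*} [Group G] {x y : G} {k : ℕ}
    (h : x * y * x⁻¹ = y ^ k) (n : ℕ) :
    x * y ^ n = y ^ (k * n) * x := by
  rw [pow_mul, ← h, conj_pow]; group

/-- In a noncommutative simple group, Burnside's transfer theorem provides an element acting
nontrivially by conjugation on a given Sylow subgroup of prime order. -/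
theorem Sylow.exists_conj_eq_pow {G : Type*} [Group G] [Finite G] [IsSimpleGroup G]
    (hG : ¬ IsMulCommutative G) {p : ℕ} [hp : Fact p.Prime] (P : Sylow p G) {y : G}
    (hy : orderOf y = p) (hP : (P : Subgroup G) = Subgroup.zpowers y) :
    ∃ x, ∃ k < p, x ∈ Subgroup.normalizer (P : Set G) ∧ x * y * x⁻¹ = y ^ k ∧ 1 < k := by
  have h := P.not_normalizer_le_centralizer hG (hy ▸ orderOf_dvd_natCard y)
  obtain ⟨x, hx, hxP⟩ := SetLike.not_le_iff_exists.mp h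
  have hyP : y ∈ (P : Subgroup G) := hP ▸ Subgroup.mem_zpowers y
  have hxy : x * y * x⁻¹ ∈ Subgroup.zpowers y :=
    hP ▸ (Subgroup.mem_normalizer_iff.mp hx y).mp hyP
  classical
  obtain ⟨k, hk⟩ := Finset.mem_image.mp (mem_zpowers_iff_mem_range_orderOf.mp hxy)
  rw [Finset.mem_range, hy] at hk
  refine ⟨x, k, hk.1, hx, hk.2.symm, ?_⟩
  by_contra! hk1
  interval_cases k
  · have : y = 1 := by simpa [eq_comm (a := (1 : G))] using hk.2
    rw [this, orderOf_one] at hy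
    exact hp.out.one_lt.ne hy
  · refine hxP fun z hz ↦ ?_
    obtain ⟨n, rfl⟩ : z ∈ Subgroup.zpowers y := hP ▸ hz
    have hc : Commute x y := by
      have := hk.2
      rw [pow_one, eq_mul_inv_iff_mul_eq] at this
      exact this.symm
    exact (hc.zpow_right n).symm.eq


/-- A simple group `G` of order `168` acts on its eight Sylow `7`-subgroups, with stabilizers of
order `21`. The Sylow subgroups can be labelled by the projective line over `ZMod 7` in such a way
that `x ↦ x + 1` and `x ↦ 2 x` are the actions of generators of the stabilizer of `∞`. -/
theorem exists_action_projectiveLine {G : Type*} [Group G] [Finite G] [IsSimpleGroup G]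
    (hG : ¬ IsMulCommutative G) (h168 : Nat.card G = 168) :
    ∃ f : G →* Equiv.Perm (OnePoint (ZMod 7)), Function.Injective f ∧
      (∀ x z, f x z = z → x ^ 21 = 1) ∧
      (∃ g, f g ∞ = ∞ ∧ ∀ x : ZMod 7, f g x = ((x + 1 : ZMod 7) : OnePoint (ZMod 7))) ∧
      ∃ y, orderOf y = 3 ∧ f y ∞ = ∞ ∧
        ∀ x : ZMod 7, f y x = ((2 * x : ZMod 7) : OnePoint (ZMod 7)) := by
  obtain ⟨P⟩ : Nonempty (Sylow 7 G) := inferInstance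
  obtain ⟨hc, hP7⟩ := P.isSylowCandidate hG (a := 1) (m := 24) (by norm_num) (by norm_num) h168
  rw [pow_one] at hP7
  have h8 : (Subgroup.normalizer (P : Set G)).index = 8 := by
    have : ∀ d ∈ Finset.range 25, IsSylowCandidate 7 1 24 d → d = 8 := by decide +kernel
    exact this _ (Finset.mem_range.mpr (Nat.lt_succ_of_le (Nat.le_of_dvd (by norm_num) hc.2.1))) hc
  have hX : Nat.card (Sylow 7 G) = 8 := P.card_eq_index_normalizer.trans h8
  -- point stabilizers have order `21`
  have h21 (Q : Sylow 7 G) (x : G) (hx : x • Q = Q) : x ^ 21 = 1 := by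
    have hQ : Nat.card (Subgroup.normalizer (Q : Set G)) = 21 := by
      have := (Subgroup.normalizer (Q : Set G)).card_mul_index
      rw [← Q.card_eq_index_normalizer, hX, h168] at this
      omega
    have := pow_card_eq_one' (x := (⟨x, Sylow.smul_eq_iff_mem_normalizer.mp hx⟩ :
      Subgroup.normalizer (Q : Set G)))
    rw [hQ] at this
    exact congrArg Subtype.val this
  -- a generator `g` of `P`, and `y` of order `3` normalizing `P`
  obtain ⟨g, hgP⟩ : ∃ g, (P : Subgroup G) = Subgroup.zpowers g := by
    have := isCyclic_of_prime_card hP7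
    exact ((P : Subgroup G).isCyclic_iff_exists_zpowers_eq_top).mp this |>.imp fun _ h ↦ h.symm
  have hg7 : orderOf g = 7 := by rw [← Nat.card_zpowers, ← hgP]; exact hP7
  have hgP' : g ∈ (P : Subgroup G) := hgP ▸ Subgroup.mem_zpowers g
  obtain ⟨y, hyP, hy3, hyg⟩ : ∃ y : G, y • P = P ∧ y ^ 3 = 1 ∧ y * g * y⁻¹ = g ^ 2 := by
    obtain ⟨n, k, hk7, hn, hnk, hk1⟩ := P.exists_conj_eq_pow hG hg7 hgP
    have hnP : n • P = P := Sylow.smul_eq_iff_mem_normalizer.mpr hn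
    have hn21 := h21 P n hnP
    -- conjugation by `n ^ 21 = 1` raises `g` to the power `k ^ 21`; by Fermat's
    -- little theorem, `k ^ 3 = 1` modulo `7`
    have hk21 : k ^ 21 % 7 = 1 % 7 := by
      have := conj_pow_pow hnk 21
      rw [hn21, one_mul, inv_one, mul_one] at this
      nth_rewrite 1 [← pow_one g] at this
      rw [pow_inj_mod, hg7] at this
      exact this.symm
    have h7 : (n ^ 7) ^ 3 = 1 := by rw [← pow_mul, hn21]
    have h14 : (n ^ 14) ^ 3 = 1 := by
      rw [← pow_mul, show 14 * 3 = 21 * 2 from rfl, pow_mul, hn21, one_pow]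
    have hs (j : ℕ) : n ^ j • P = P := MulAction.mem_stabilizer_iff.mp
      (Subgroup.pow_mem (MulAction.stabilizer G P) (MulAction.mem_stabilizer_iff.mpr hnP) j)
    have hk : k = 2 ∨ k = 4 := by
      interval_cases k <;> simp_all
    -- `7` and `14` are multiples of `7` with `2 ^ 7 = 4 ^ 14 = 2` modulo `7`
    rcases hk with rfl | rfl
    · refine ⟨n ^ 7, hs 7, h7, (conj_pow_pow hnk 7).trans ?_⟩
      rw [pow_inj_mod, hg7]
      norm_num
    · refine ⟨n ^ 14, hs 14, h14, (conj_pow_pow hnk 14).trans ?_⟩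
      rw [pow_inj_mod, hg7]
      norm_num
  have hyg1 (j : ℕ) := mul_pow_eq_pow_mul_of_conj hyg j
  have hy1 : y ≠ 1 := by
    rintro rfl
    have : g ^ 1 = g ^ 2 := by simpa using hyg
    rw [pow_inj_mod, hg7] at this
    norm_num at this
  have hyo : orderOf y = 3 := orderOf_eq_prime hy3 hy1
  -- a second fixed point of `y`, as the number of fixed points is `8 = 2` modulo `3`
  obtain ⟨Q, hQP, hyQ⟩ : ∃ Q : Sylow 7 G, Q ≠ P ∧ y • Q = Q := by
    have hp3 : IsPGroup 3 (Subgroup.zpowers y) :=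
      IsPGroup.of_card (n := 1) (by rw [Nat.card_zpowers, hyo, pow_one])
    have hmod := hp3.card_modEq_card_fixedPoints (Sylow 7 G)
    by_contra! h
    have hfix : MulAction.fixedPoints (Subgroup.zpowers y) (Sylow 7 G) = {P} := by
      ext Q
      refine ⟨fun hQ ↦ ?_, ?_⟩
      · by_contra hne
        exact h Q hne (hQ ⟨y, Subgroup.mem_zpowers y⟩)
      · rintro rfl ⟨_, j, rfl⟩
        exact Subgroup.zpow_mem (MulAction.stabilizer G Q) (MulAction.mem_stabilizer_iff.mpr hyP) j
    rw [hX, hfix] at hmod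
    simp [Nat.ModEq] at hmod
  -- a Sylow subgroup `P` normalizing another one `Q` would be equal to it
  have hgQ : g • Q ≠ Q := fun h ↦ by
    have hgN : g ∈ Subgroup.normalizer (Q : Set G) := Sylow.smul_eq_iff_mem_normalizer.mp h
    have hPN : (P : Subgroup G) ≤ Subgroup.normalizer (Q : Set G) := by
      rw [hgP, Subgroup.zpowers_le]; exact hgN
    have := P.isPGroup'.inf_normalizer_sylow Q
    rw [inf_eq_left.mpr hPN, eq_comm, inf_eq_left] at this
    exact hQP (Sylow.ext (P.is_maximal' Q.isPGroup' this))
  -- labelling of the Sylow subgroups by the projective line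
  let e₀ : OnePoint (ZMod 7) → Sylow 7 G := fun z ↦ z.elim P fun x ↦ g ^ x.val • Q
  have e₀_coe (n : ℕ) : e₀ ((n : ZMod 7) : OnePoint (ZMod 7)) = g ^ n • Q := by
    change g ^ (n : ZMod 7).val • Q = _
    congr 1
    rw [ZMod.val_natCast, pow_inj_mod, hg7, Nat.mod_mod]
  have hgP1 (j : ℕ) : g ^ j • P = P :=
    Sylow.smul_eq_iff_mem_normalizer.mpr (Subgroup.le_normalizer (pow_mem hgP' j))
  have he₀ : Function.Bijective e₀ := by
    refine (Nat.bijective_iff_injective_and_card e₀).mpr ⟨?_, ?_⟩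
    swap
    · rw [hX, Nat.card_eq_fintype_card]
      rfl
    have hper : MulAction.period g Q = 7 := by
      have h1 := MulAction.period_dvd_orderOf g Q
      rw [hg7, Nat.dvd_prime (by norm_num)] at h1
      refine h1.resolve_left fun h1 ↦ hgQ ?_
      simpa [h1] using MulAction.pow_period_smul g Q
    have hne (n : ℕ) : g ^ n • Q ≠ P := fun h ↦ hQP <| by
      rwa [← hgP1 n, smul_left_cancel_iff] at h
    intro a b hab
    cases a with
    | infty =>
      cases b with
      | infty => rfl
      | coe b => exact absurd hab.symm (hne _)
    | coe a =>
      cases b with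
      | infty => exact absurd hab (hne _)
      | coe b =>
        have h1 : g ^ ((a.val : ℤ) - b.val) • Q = Q := by
          rw [sub_eq_neg_add, zpow_add, mul_smul, zpow_neg, inv_smul_eq_iff]
          rw [zpow_natCast, zpow_natCast]
          exact hab
        rw [MulAction.zpow_smul_eq_iff_period_dvd, hper] at h1
        have := a.val_lt
        have := b.val_lt
        rw [ZMod.val_injective 7 (show a.val = b.val by omega)]
  let e := Equiv.ofBijective e₀ he₀
  let f : G →* Equiv.Perm (OnePoint (ZMod 7)) :=
    e.symm.permCongrHom.toMonoidHom.comp (MulAction.toPermHom G (Sylow 7 G))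
  have hf (x : G) (z : OnePoint (ZMod 7)) : e₀ (f x z) = x • e₀ z :=
    e.apply_symm_apply (x • e z)
  have hfix (x : G) (z : OnePoint (ZMod 7)) (h : f x z = z) : x • e₀ z = e₀ z := by
    rw [← hf, h]
  have hfg (x : ZMod 7) : f g x = ((x + 1 : ZMod 7) : OnePoint (ZMod 7)) := by
    refine he₀.1 ?_
    obtain ⟨n, rfl⟩ := ZMod.natCast_zmod_surjective x
    rw [hf, ← Nat.cast_succ, e₀_coe, e₀_coe, pow_succ', mul_smul]
  have hfg_infty : f g ∞ = ∞ := he₀.1 ((hf g ∞).trans ((pow_one g ▸ hgP1 1 :)))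
  have hfy (x : ZMod 7) : f y x = ((2 * x : ZMod 7) : OnePoint (ZMod 7)) := by
    refine he₀.1 ?_
    obtain ⟨n, rfl⟩ := ZMod.natCast_zmod_surjective x
    rw [hf, e₀_coe, ← mul_smul, hyg1, mul_smul, hyQ, ← e₀_coe]
    push_cast
    rfl
  have hfy_infty : f y ∞ = ∞ := he₀.1 ((hf y ∞).trans hyP)
  refine ⟨f, ?_, fun x z h ↦ h21 (e₀ z) x (hfix x z h), ⟨g, hfg_infty, hfg⟩,
    ⟨y, hyo, hfy_infty, hfy⟩⟩
  classical
  obtain ⟨ψ, hψ, hψf⟩ := exists_injective_alternatingGroup hG f fun h ↦ by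
    have := hfg 0
    rw [h] at this
    simp at this
  exact fun a b hab ↦ hψ (Subtype.ext (by rw [hψf, hψf, hab]))

/-- Suppose that `y` acts as `x ↦ 2 x`, and that point stabilizers have exponent dividing `21`. Any
element which inverts `y` exchanges the two fixed points of `y`. -/
theorem swap_of_conj_eq_sq {G : Type*} [Group G] {f : G →* Equiv.Perm (OnePoint (ZMod 7))}
    (h21 : ∀ x z, f x z = z → x ^ 21 = 1) {y : G} (hyo : orderOf y = 3) (hfy_infty : f y ∞ = ∞)
    (hfy : ∀ x : ZMod 7, f y x = ((2 * x : ZMod 7) : OnePoint (ZMod 7)))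
    {v : G} (hv : v * y * v⁻¹ = y ^ 2) :
    f v ∞ = (0 : ZMod 7) ∧ f v (0 : ZMod 7) = ∞ := by
  have hy3 : y ^ 3 = 1 := hyo ▸ pow_orderOf_eq_one y
  have hyfix (z : OnePoint (ZMod 7)) (h : f y z = z) : z = ∞ ∨ z = (0 : ZMod 7) := by
    cases z with
    | infty => exact .inl rfl
    | coe x =>
      rw [hfy, coe_eq_coe] at h
      right
      rw [coe_eq_coe]
      linear_combination h
  have hvy : y * v = v * y ^ 2 := by
    rw [mul_pow_eq_pow_mul_of_conj hv, show 2 * 2 = 3 + 1 from rfl, pow_succ, hy3, one_mul]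
  have hv1 (z : OnePoint (ZMod 7)) (hz : f y z = z) : f y (f v z) = f v z := by
    rw [← Equiv.Perm.mul_apply, ← map_mul, hvy, map_mul, map_pow, Equiv.Perm.mul_apply, sq,
      Equiv.Perm.mul_apply, hz, hz]
  -- otherwise `v ^ 21 = 1`, although `v ^ 21` inverts `y` because `2 ^ 21 = 2` modulo `3`
  have h1 : f v ∞ ≠ ∞ := fun h ↦ by
    have := conj_pow_pow hv 21
    rw [h21 v ∞ h, one_mul, inv_one, mul_one] at this
    nth_rewrite 1 [← pow_one y] at this
    rw [pow_inj_mod, hyo] at this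
    norm_num at this
  have h2 := (hyfix _ (hv1 _ hfy_infty)).resolve_left h1
  refine ⟨h2, (hyfix _ (hv1 _ (by simp [hfy]))).resolve_right fun h ↦ ?_⟩
  exact coe_ne_infty _ ((f v).injective (h.trans h2.symm))

/-- The subgroup generated by `y` is a Sylow `3`-subgroup, so it is inverted by some element, of
which an odd power is an involution. -/
theorem exists_involution_conj_eq_sq {G : Type*} [Group G] [Finite G] [IsSimpleGroup G]
    (hG : ¬ IsMulCommutative G) (h168 : Nat.card G = 168)
    {f : G →* Equiv.Perm (OnePoint (ZMod 7))}
    (h21 : ∀ x z, f x z = z → x ^ 21 = 1) {y : G} (hyo : orderOf y = 3) (hfy_infty : f y ∞ = ∞)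
    (hfy : ∀ x : ZMod 7, f y x = ((2 * x : ZMod 7) : OnePoint (ZMod 7))) :
    ∃ w : G, w ^ 2 = 1 ∧ w * y * w⁻¹ = y ^ 2 := by
  obtain ⟨R, hR⟩ := (IsPGroup.of_card (n := 1) (p := 3) (G := Subgroup.zpowers y)
    (by rw [Nat.card_zpowers, hyo, pow_one])).exists_le_sylow
  have hR3 := (R.isSylowCandidate hG (a := 1) (m := 56) (by norm_num) (by norm_num) h168).2
  have hRy : (R : Subgroup G) = Subgroup.zpowers y := by
    refine (Subgroup.eq_of_le_of_card_ge hR ?_).symm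
    rw [Nat.card_zpowers, hyo]
    exact hR3.le
  have : Fact (Nat.Prime 3) := ⟨by norm_num⟩
  obtain ⟨u, k, hk3, -, huy, hk1⟩ := R.exists_conj_eq_pow hG hyo hRy
  obtain rfl : k = 2 := by omega
  obtain ⟨h1, h2⟩ := swap_of_conj_eq_sq h21 hyo hfy_infty hfy huy
  -- `u ^ 2` fixes `∞`, so `u ^ 42 = 1`, and odd powers of `u` invert `y`
  refine ⟨u ^ 21, ?_, (conj_pow_pow huy 21).trans ?_⟩
  · rw [← pow_mul, mul_comm, pow_mul]
    refine h21 _ ∞ ?_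
    rw [map_pow, sq, Equiv.Perm.mul_apply, h1, h2]
  · rw [pow_inj_mod, hyo]
    norm_num

theorem homography_inversionMatrix (x : ZMod 7) (hx : x ≠ 0) :
    homography (ZMod 7) (inversionMatrix (ZMod 7)) x = ((-x⁻¹ : ZMod 7) : OnePoint (ZMod 7)) := by
  rw [homography_coe]
  simp [inversionMatrix, hx, neg_div]

/-- An involution `v` inverting `x ↦ 2 x` acts as `x ↦ c / x` with a nonsquare `c = f v 1`; when
`c = -1`, it is the standard inversion. -/
theorem exists_nonsquare_apply_one {G : Type*} [Group G]
    {f : G →* Equiv.Perm (OnePoint (ZMod 7))}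
    (h21 : ∀ x z, f x z = z → x ^ 21 = 1) {y : G} (hyo : orderOf y = 3) (hfy_infty : f y ∞ = ∞)
    (hfy : ∀ x : ZMod 7, f y x = ((2 * x : ZMod 7) : OnePoint (ZMod 7)))
    {v : G} (hv2 : v ^ 2 = 1) (hv : v * y * v⁻¹ = y ^ 2) :
    ∃ c : ZMod 7, (c = 3 ∨ c = 5 ∨ c = 6) ∧ f v (1 : ZMod 7) = c ∧
      (c = 6 → f v = homography (ZMod 7) (inversionMatrix (ZMod 7))) := by
  obtain ⟨h_infty, h_zero⟩ := swap_of_conj_eq_sq h21 hyo hfy_infty hfy hv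
  have hinv (a b : OnePoint (ZMod 7)) (h : f v a = b) : f v b = a := by
    rw [← h, ← Equiv.Perm.mul_apply, ← map_mul, ← sq, hv2, map_one, Equiv.Perm.one_apply]
  have hne (z : OnePoint (ZMod 7)) : f v z ≠ z := fun h ↦ by
    have : v = 1 := by
      calc v = v ^ 21 * ((v ^ 2) ^ 10)⁻¹ := by group
        _ = 1 := by rw [h21 v z h, hv2]; simp
    rw [this, map_one] at h_infty
    simp at h_infty
  -- `v` intertwines `x ↦ 2 x` with its inverse `x ↦ 4 x`
  have hmul (x c : ZMod 7) (hx : f v x = c) : f v (2 * x : ZMod 7) = (4 * c : ZMod 7) := by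
    have hvy : v * y = y ^ 2 * v := by rw [← hv]; group
    rw [← hfy, ← Equiv.Perm.mul_apply, ← map_mul, hvy, map_mul, map_pow, Equiv.Perm.mul_apply,
      sq, Equiv.Perm.mul_apply, hx, hfy, hfy]
    ring_nf
  obtain ⟨c, hc⟩ : ∃ c : ZMod 7, f v (1 : ZMod 7) = c := by
    refine (OnePoint.ne_infty_iff_exists.mp fun h ↦ ?_).imp fun _ h ↦ h.symm
    have := (f v).injective (h.trans h_zero.symm)
    simp at this
  have hc2 : f v (2 : ZMod 7) = (4 * c : ZMod 7) := by simpa using hmul 1 c hc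
  have hc4 : f v (4 : ZMod 7) = (2 * c : ZMod 7) := by
    have h := hmul 2 _ hc2
    rwa [show (2 * 2 : ZMod 7) = 4 by decide, ← mul_assoc,
      show (4 * 4 : ZMod 7) = 2 by decide] at h
  refine ⟨c, ?_, hc, ?_⟩
  · -- a square root of `c` would be a fixed point
    have hcases : ∀ c : ZMod 7,
        c = 0 ∨ c = 1 ∨ 2 * c = 4 ∨ 4 * c = 2 ∨ c = 3 ∨ c = 5 ∨ c = 6 := by
      decide
    rcases hcases c with h | h | h | h | h
    · have := (f v).injective ((h ▸ hc).trans h_infty.symm)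
      simp at this
    · exact absurd (h ▸ hc) (hne _)
    · exact absurd (h ▸ hc4) (hne _)
    · exact absurd (h ▸ hc2) (hne _)
    · exact h
  · rintro rfl
    ext z
    cases z with
    | infty =>
      rw [h_infty, homography_infty]
      simp [inversionMatrix]
    | coe x =>
      -- `4 * 6` and `2 * 6` are the forms in which the values at `2` and `4` are known
      have hx : ∀ x : ZMod 7, x = 0 ∨ x = 1 ∨ x = 2 ∨ x = 4 ∨ x = 6 ∨ x = 4 * 6 ∨ x = 2 * 6 := by
        decide
      rcases hx x with rfl | hx
      · rw [h_zero, homography_coe]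
        simp [inversionMatrix]
      · rw [homography_inversionMatrix x (by rintro rfl; revert hx; decide)]
        rcases hx with rfl | rfl | rfl | rfl | rfl | rfl
        · rw [hc]; exact congrArg _ (by decide +kernel)
        · rw [hc2]; exact congrArg _ (by decide +kernel)
        · rw [hc4]; exact congrArg _ (by decide +kernel)
        · rw [hinv _ _ hc]; exact congrArg _ (by decide +kernel)
        · rw [hinv _ _ hc2]; exact congrArg _ (by decide +kernel)
        · rw [hinv _ _ hc4]; exact congrArg _ (by decide +kernel)

/-- A simple group of order `168` contains `x ↦ x + 1` and `x ↦ -1 / x` in its action on its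
Sylow `7`-subgroups, labelled by the projective line over `ZMod 7`. -/
theorem nonempty_mulEquiv_of_card_eq_168 {G : Type*} [Group G] [Finite G] [IsSimpleGroup G]
    (hG : ¬ IsMulCommutative G) (h168 : Nat.card G = 168) :
    Nonempty (G ≃* Matrix.ProjectiveSpecialLinearGroup (Fin 2) (ZMod 7)) := by
  obtain ⟨f, hf, h21, ⟨g, hg_infty, hg⟩, y, hyo, hfy_infty, hfy⟩ :=
    exists_action_projectiveLine hG h168
  obtain ⟨w, hw2, hwy⟩ := exists_involution_conj_eq_sq hG h168 h21 hyo hfy_infty hfy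
  refine nonempty_mulEquiv_projectiveSpecialLinearGroup h168 f hf ⟨g, ?_⟩ ?_
  · ext z
    cases z with
    | infty =>
      rw [hg_infty, homography_infty]
      simp [Matrix.SpecialLinearGroup.transvection_coe]
    | coe x =>
      rw [hg, homography_coe]
      simp [Matrix.SpecialLinearGroup.transvection_coe]
  · -- multiplying the involution by `y` multiplies the nonsquare `c` by `2`
    have hstep (v : G) (hv2 : v ^ 2 = 1) (hv : v * y * v⁻¹ = y ^ 2) :
        (y * v) ^ 2 = 1 ∧ (y * v) * y * (y * v)⁻¹ = y ^ 2 := by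
      constructor
      · calc (y * v) ^ 2 = y * (v * y * v⁻¹) * v ^ 2 := by rw [sq, sq]; group
          _ = y ^ 3 := by rw [hv, hv2, mul_one, ← pow_succ']
          _ = 1 := hyo ▸ pow_orderOf_eq_one y
      · calc (y * v) * y * (y * v)⁻¹ = y * (v * y * v⁻¹) * y⁻¹ := by group
          _ = y ^ 2 := by rw [hv]; group
    have hmem (v : G) (hv2 : v ^ 2 = 1) (hv : v * y * v⁻¹ = y ^ 2)
        (h6 : f v (1 : ZMod 7) = (6 : ZMod 7)) :
        homography (ZMod 7) (inversionMatrix (ZMod 7)) ∈ f.range := by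
      obtain ⟨c, -, hc, h⟩ := exists_nonsquare_apply_one h21 hyo hfy_infty hfy hv2 hv
      exact ⟨v, h (coe_eq_coe.mp (hc.symm.trans h6))⟩
    obtain ⟨c, hc, hw1, -⟩ := exists_nonsquare_apply_one h21 hyo hfy_infty hfy hw2 hwy
    obtain ⟨hw2', hwy'⟩ := hstep w hw2 hwy
    obtain ⟨hw2'', hwy''⟩ := hstep _ hw2' hwy'
    rcases hc with rfl | rfl | rfl
    · refine hmem _ hw2' hwy' ?_
      rw [map_mul, Equiv.Perm.mul_apply, hw1, hfy]
      exact congrArg _ (by decide +kernel)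
    · refine hmem _ hw2'' hwy'' ?_
      rw [map_mul, Equiv.Perm.mul_apply, map_mul, Equiv.Perm.mul_apply, hw1, hfy, hfy]
      exact congrArg _ (by decide +kernel)
    · exact hmem w hw2 hwy hw1

end

/-! ### Perfect and simple groups of order at most 200 -/

theorem mainTheorem8 (G : Type*) [Group G] [Finite G] (hG : Nat.card G ≤ 200) :
    (Group.IsPerfect G → Nontrivial G → Nat.card G ∈ ({60, 120, 168, 180} : Set ℕ)) ∧
    (IsSimpleGroup G → ¬ IsMulCommutative G →
      (Nat.card G = 60 ∧ Nonempty (G ≃* alternatingGroup (Fin 5))) ∨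
      (Nat.card G = 168 ∧
        Nonempty (G ≃* Matrix.ProjectiveSpecialLinearGroup (Fin 2) (ZMod 7)))) := by
  refine ⟨fun _ _ ↦ ?_, fun _ hcomm ↦ ?_⟩
  · have hpos : 0 < Nat.card G := Nat.card_pos
    have := dvd_card_of_isPerfect _ G rfl hG
    simp only [Set.mem_insert_iff, Set.mem_singleton_iff]
    omega
  · exact (card_eq_of_isSimpleGroup hcomm hG).imp
      (fun h ↦ ⟨h, nonempty_mulEquiv_alternatingGroup_five hcomm h⟩)
      (fun h ↦ ⟨h, nonempty_mulEquiv_of_card_eq_168 hcomm h⟩)
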